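/- Let $a_0\in\mathbb{R}$ with $|a_0|<1$ and $\sigma^2>0$, let $\{e_t\}_{t\in\mathbb{Z}}$ be a Gaussian white noise of variance $\sigma^2$ (i.e. independent $\mathcal{N}(0,\sigma^2)$ random variables), and let $\{y_t\}_{t\in\mathbb{Z}}$ be a (strictly) stationary process satisfying $$y_t=a_0y_{t-1}+e_t\quad\text{almost surely, for all } t\in\mathbb{Z}.$$ For $N\ge 2$ let $\hat a_N=\dfrac{\sum_{t=2}^N y_ty_{t-1}}{\sum_{t=1}^{N-1}y_t^2}$ be the least-squares estimate of $a_0$ from $y_1,\dots,y_N$. Then, for all $\varepsilon>0$ and all $N\ge 2$, $$\mathbb{P}(\hat a_N-a_0>\varepsilon)\le\left(\frac{1-a_0^2}{1-a_0^2+\varepsilon^2}\right)^{1/4}\left(\frac{1+a_0^2+\varepsilon^2}{2}+\sqrt{\left(\frac{1+a_0^2+\varepsilon^2}{2}\right)^2-a_0^2}\right)^{-(N-2)/4}.$$ Furthermore, for all $N\ge 7$, the quantity $\operatorname{var}\{\hat a_N\}:=\mathbb{E}[(\hat a_N-a_0)^2]$ is finite and $$\operatorname{var}\{\hat a_N\}\le\frac{8}{N-6}-\frac{8a_0^2}{N+2}.$$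 -/

import Mathlib

open MeasureTheory ProbabilityTheory
open scoped NNReal

/-- `e` is a Gaussian white noise of variance `v` (indexed by all integer times): the `e t` are
independent, each with law `N(0, v)`. -/
structure IsGaussianWhiteNoise {Ω : Type*} [MeasurableSpace Ω] (e : ℤ → Ω → ℝ) (v : ℝ≥0)
    (μ : Measure Ω) : Prop where
  indep : iIndepFun e μ
  hasLaw : ∀ t, HasLaw (e t) (gaussianReal 0 v) μ

/-- `y` solves the first order autoregressive equation `y t = a * y (t - 1) + e t` at all integer
times `t`, almost surely. -/
def IsAR1 {Ω : Type*} [MeasurableSpace Ω] (y e : ℤ → Ω → ℝ) (a : ℝ) (μ : Measure Ω) : Prop :=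
  ∀ t : ℤ, ∀ᵐ ω ∂μ, y t ω = a * y (t - 1) ω + e t ω

/-- (Strict) stationarity: the finite dimensional distributions of `y` are invariant under time
shifts. (`IdentDistrib` includes a.e.-measurability.) -/
def IsStationaryProcess {Ω : Type*} [MeasurableSpace Ω] (y : ℤ → Ω → ℝ) (μ : Measure Ω) : Prop :=
  ∀ (I : Finset ℤ) (h : ℤ),
    IdentDistrib (fun ω (t : I) ↦ y (t : ℤ) ω) (fun ω (t : I) ↦ y ((t : ℤ) + h) ω) μ μ

/-- The least squares estimate of the parameter from the data `y 1, …, y N`: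
`(∑_{t=2}^N y_t y_{t-1}) / (∑_{t=1}^{N-1} y_t ^ 2)`. -/
noncomputable def lsEstimate {Ω : Type*} (y : ℤ → Ω → ℝ) (N : ℕ) (ω : Ω) : ℝ :=
  (∑ t ∈ Finset.Icc (2 : ℤ) (N : ℤ), y t ω * y (t - 1) ω) /
    ∑ t ∈ Finset.Icc (1 : ℤ) ((N : ℤ) - 1), y t ω ^ 2

/-!
The proof is Chernoff's method. With `M = ∑ e_t y_{t-1}` (the score) and `S = ∑ y_{t-1}²` (the
energy) the estimation error is `M / S`, so the event `M / S > ε` is contained in `M - ε S ≥ 0`, and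
its probability is at most `E exp (λ (M - ε S))`. For `λ = ε / (2 v)` the Cauchy-Schwarz inequality
bounds this by the square root of

* `E exp (2 λ M - (2 λ)² v / 2 * S)`, an exponential martingale, which has mean one
  (`IsCausalAR1.lintegral_exp_score`), times
* `E exp (-ε² S / (2 v))`, a Laplace transform of a Gaussian quadratic form
  (`IsCausalAR1.lintegral_exp_energy_le`).

The latter is computed by integrating out the noise variables backwards in time: a weight `c` on
the last square becomes a weight `s + a² c / (1 + c)` on the square before, where `s = ε²`. An
explicit eigenfunction of this recursion gives geometric decay with rate the larger root of
`r² - (1 + a² + s) r + a²` (`dominantRoot`). The other tail obeys the same bound. The second moment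
is the integral of the two tail bounds over `s > 0`, which becomes elementary with the root `r` as
integration variable, since `s = r - 1 - a² + a² / r` (`lintegral_dominantRoot_rpow`).

All this uses that `y` is causal, i.e. that `e (t + 1)` is independent of the past of `y` and `e` up
to time `t`, and that `y t` has law `N(0, v / (1 - a²))`. Both follow from stationarity: the
remainder `aⁿ y (t - n)` in the moving average representation of `y t` tends to zero in probability
(`exists_isCausalAR1`).
-/

/-! ### Gaussian integrals -/

theorem lintegral_gaussianReal_eq {v : ℝ≥0} (hv : v ≠ 0) {f : ℝ → ENNReal} (hf : Measurable f) :
    ∫⁻ z, f z ∂(gaussianReal 0 v) = ∫⁻ z, gaussianPDF 0 v z * f z := by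
  rw [gaussianReal_of_var_ne_zero _ hv,
    lintegral_withDensity_eq_lintegral_mul _ (measurable_gaussianPDF 0 v) hf]
  rfl

/-- The exponential martingale increment of a Gaussian variable has mean one: tilting the density
of `N(0, v)` by `exp (u z - u² v / 2)` gives the density of `N(u v, v)`. -/
theorem lintegral_exp_linear_gaussianReal {v : ℝ≥0} (hv : v ≠ 0) (u : ℝ) :
    ∫⁻ z, ENNReal.ofReal (Real.exp (u * z - u ^ 2 * v / 2)) ∂(gaussianReal 0 v) = 1 := by
  have hv' : (v : ℝ) ≠ 0 := by exact_mod_cast hv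
  rw [lintegral_gaussianReal_eq hv (by fun_prop), ← lintegral_gaussianPDF_eq_one (u * v) hv]
  refine lintegral_congr fun z ↦ ?_
  rw [gaussianPDF, gaussianPDF, ← ENNReal.ofReal_mul (gaussianPDFReal_nonneg _ _ _),
    gaussianPDFReal, gaussianPDFReal, mul_assoc, ← Real.exp_add]
  congr 3
  field_simp
  ring

/-- The Laplace transform of the square of a shifted Gaussian variable: tilting the density of
`N(0, v)` by `exp (-c (b + z)² / (2 v))` gives, up to a constant, the density of
`N(-c b / (1 + c), v / (1 + c))`. -/
theorem lintegral_exp_neg_sq_gaussianReal {v : ℝ≥0} (hv : v ≠ 0) {c : ℝ} (hc : 0 ≤ c) (b : ℝ) :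
    ∫⁻ z, ENNReal.ofReal (Real.exp (-(c * (b + z) ^ 2) / (2 * v))) ∂(gaussianReal 0 v) =
      ENNReal.ofReal ((√(1 + c))⁻¹ * Real.exp (-(c / (1 + c) * b ^ 2) / (2 * v))) := by
  have hv' : 0 < (v : ℝ) := by exact_mod_cast pos_iff_ne_zero.mpr hv
  have hc1 : 0 < 1 + c := by linarith
  set w : ℝ≥0 := v / ⟨1 + c, hc1.le⟩ with hw
  have hwr : (w : ℝ) = v / (1 + c) := by rw [hw]; rfl
  have hw0 : w ≠ 0 := by
    intro h
    have : (w : ℝ) = 0 := by rw [h]; rfl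
    rw [hwr] at this
    have : 0 < (v : ℝ) / (1 + c) := by positivity
    linarith
  rw [lintegral_gaussianReal_eq hv (by fun_prop),
    ← mul_one (ENNReal.ofReal ((√(1 + c))⁻¹ * _)),
    ← lintegral_gaussianPDF_eq_one (-(c * b) / (1 + c)) hw0,
    ← lintegral_const_mul _ (measurable_gaussianPDF _ _)]
  refine lintegral_congr fun z ↦ ?_
  rw [gaussianPDF, gaussianPDF, ← ENNReal.ofReal_mul (gaussianPDFReal_nonneg _ _ _),
    ← ENNReal.ofReal_mul (by positivity), gaussianPDFReal, gaussianPDFReal, mul_assoc,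
    ← Real.exp_add, hwr]
  have h1 : (√(2 * Real.pi * v))⁻¹ = (√(1 + c))⁻¹ * (√(2 * Real.pi * (v / (1 + c))))⁻¹ := by
    rw [← mul_inv, ← Real.sqrt_mul hc1.le]
    congr 2
    field_simp
  rw [h1, mul_mul_mul_comm, ← Real.exp_add]
  congr 3
  field_simp
  ring

/-! ### The dominant root of the characteristic polynomial -/

/-- The larger root of `r² - (1 + a² + s) r + a²`, the characteristic polynomial of the recursion
satisfied by the determinants of the tridiagonal Toeplitz matrices with diagonal `1 + a² + s` and
off-diagonal `-a`. -/
noncomputable def dominantRoot (a s : ℝ) : ℝ :=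
  (1 + a ^ 2 + s) / 2 + √(((1 + a ^ 2 + s) / 2) ^ 2 - a ^ 2)

theorem dominantRoot_eq {a s : ℝ} (hs : 0 ≤ s) :
    s * dominantRoot a s = (dominantRoot a s - 1) * (dominantRoot a s - a ^ 2) := by
  have h : 0 ≤ ((1 + a ^ 2 + s) / 2) ^ 2 - a ^ 2 := by
    nlinarith [sq_nonneg (1 - a ^ 2), mul_nonneg hs (sq_nonneg a)]
  have := Real.sq_sqrt h
  unfold dominantRoot
  linear_combination -this

theorem one_lt_dominantRoot {a s : ℝ} (hs : 0 < s) : 1 < dominantRoot a s := by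
  have h : (1 - a ^ 2 - s) / 2 < √(((1 + a ^ 2 + s) / 2) ^ 2 - a ^ 2) := by
    apply Real.lt_sqrt_of_sq_lt
    nlinarith
  unfold dominantRoot
  linarith

theorem one_add_le_dominantRoot {a s : ℝ} (hs : 0 < s) :
    1 + s ≤ dominantRoot a s := by
  have h1 := one_lt_dominantRoot (a := a) hs
  have h2 := dominantRoot_eq (a := a) hs.le
  nlinarith [mul_nonneg (sub_pos.mpr h1).le (sq_nonneg a)]

theorem dominantRoot_sub_add_div {a r : ℝ} (ha : a ^ 2 < 1) (hr : 1 < r) :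
    dominantRoot a (r - 1 - a ^ 2 + a ^ 2 / r) = r := by
  have hr0 : r ≠ 0 := by positivity
  have h0 : a ^ 2 / r ≤ r := by
    rw [div_le_iff₀ (by linarith)]
    nlinarith
  have h : ((1 + a ^ 2 + (r - 1 - a ^ 2 + a ^ 2 / r)) / 2) ^ 2 - a ^ 2 =
      ((r - a ^ 2 / r) / 2) ^ 2 := by
    field_simp
    ring
  rw [dominantRoot, h, Real.sqrt_sq (by linarith)]
  ring

/-- The parametrisation `s = r - 1 - a² + a² / r` of `s > 0` by the dominant root `r > 1`. -/
theorem image_Ioi_one_eq_Ioi_zero {a : ℝ} (ha : a ^ 2 < 1) :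
    (fun r : ℝ ↦ r - 1 - a ^ 2 + a ^ 2 / r) '' Set.Ioi 1 = Set.Ioi 0 := by
  ext s
  constructor
  · rintro ⟨r, hr, rfl⟩
    have hr' : 1 < r := hr
    have : r - 1 - a ^ 2 + a ^ 2 / r = (r - 1) * (r - a ^ 2) / r := by
      field_simp
      ring
    simp only [Set.mem_Ioi, this]
    exact div_pos (mul_pos (by linarith) (by linarith)) (by linarith)
  · intro hs
    have h1 := one_lt_dominantRoot (a := a) hs
    refine ⟨dominantRoot a s, h1, ?_⟩
    have h2 := dominantRoot_eq (a := a) (le_of_lt hs)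
    have h3 : dominantRoot a s ≠ 0 := by positivity
    field_simp
    linear_combination -h2

/-- The integral over `s > 0` of a power of the dominant root, computed by integrating in the root
instead, where `ds = (1 - a² / r²) dr`. -/
theorem lintegral_dominantRoot_rpow {a p : ℝ} (ha : a ^ 2 < 1) (hp : 1 < p) :
    ∫⁻ s in Set.Ioi (0 : ℝ), ENNReal.ofReal (dominantRoot a s ^ (-p)) =
      ENNReal.ofReal (1 / (p - 1) - a ^ 2 / (p + 1)) := by
  have hmeas : MeasurableSet (Set.Ioi (1 : ℝ)) := measurableSet_Ioi
  rw [← image_Ioi_one_eq_Ioi_zero ha,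
    lintegral_image_eq_lintegral_abs_deriv_mul (f' := fun r ↦ 1 - a ^ 2 / r ^ 2) hmeas]
  · have hint : IntegrableOn (fun r : ℝ ↦ r ^ (-p) - a ^ 2 * r ^ (-p - 2)) (Set.Ioi 1) :=
      (integrableOn_Ioi_rpow_of_lt (by linarith) one_pos).sub
        ((integrableOn_Ioi_rpow_of_lt (by linarith) one_pos).const_mul _)
    have hpt : ∀ r ∈ Set.Ioi (1 : ℝ),
        r ^ (-p) - a ^ 2 * r ^ (-p - 2) = (1 - a ^ 2 / r ^ 2) * r ^ (-p) := by
      intro r hr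
      have hr' : 0 < r := one_pos.trans hr
      rw [Real.rpow_sub hr', Real.rpow_two]
      ring
    have hnn : ∀ r ∈ Set.Ioi (1 : ℝ), 0 ≤ 1 - a ^ 2 / r ^ 2 := by
      intro r hr
      have hr' : 1 < r := hr
      have : a ^ 2 / r ^ 2 ≤ 1 := by
        rw [div_le_one (by positivity)]
        nlinarith
      linarith
    have hval : ∫ r in Set.Ioi (1 : ℝ), (r ^ (-p) - a ^ 2 * r ^ (-p - 2)) =
        1 / (p - 1) - a ^ 2 / (p + 1) := by
      rw [integral_sub (integrableOn_Ioi_rpow_of_lt (by linarith) one_pos)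
        ((integrableOn_Ioi_rpow_of_lt (by linarith) one_pos).const_mul _), integral_const_mul,
        integral_Ioi_rpow_of_lt (by linarith) one_pos,
        integral_Ioi_rpow_of_lt (by linarith) one_pos, Real.one_rpow, Real.one_rpow]
      have h1 : p - 1 ≠ 0 := by linarith
      have h2 : p + 1 ≠ 0 := by linarith
      have h3 : -p + 1 ≠ 0 := by intro h; apply h1; linarith
      have h4 : -p - 2 + 1 ≠ 0 := by intro h; apply h2; linarith
      field_simp
      ring
    rw [← hval, ofReal_integral_eq_lintegral_ofReal hint]
    · refine setLIntegral_congr_fun hmeas fun r hr ↦ ?_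
      rw [dominantRoot_sub_add_div ha hr, hpt r hr, abs_of_nonneg (hnn r hr),
        ENNReal.ofReal_mul (hnn r hr)]
    · filter_upwards [ae_restrict_mem hmeas] with r hr
      rw [hpt r hr]
      exact mul_nonneg (hnn r hr) (Real.rpow_nonneg (one_pos.trans hr).le _)
  · intro r hr
    have hr' : r ≠ 0 := (one_pos.trans hr).ne'
    have h := (((hasDerivAt_id r).sub_const 1).sub_const (a ^ 2)).add
      ((hasDerivAt_const r (a ^ 2)).div (hasDerivAt_id r) hr')
    refine HasDerivAt.hasDerivWithinAt (h.congr_deriv ?_)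
    simp [sub_eq_add_neg, neg_div]
  · intro r hr r' hr' h
    rw [← dominantRoot_sub_add_div ha hr, ← dominantRoot_sub_add_div ha hr']
    exact congrArg _ h

/-! ### Gaussian autoregressive processes adapted to a filtration -/

/-- Integrating out a random variable independent of a sub-σ-algebra, the other factors being
measurable for it. -/
theorem lintegral_mul_of_indep {Ω : Type*} {m₁ m : MeasurableSpace Ω} {μ : Measure Ω}
    [IsProbabilityMeasure μ] (hm : m₁ ≤ m)
    {G : Ω → ENNReal} {X Y : Ω → ℝ} (hG : Measurable[m₁] G) (hX : Measurable[m₁] X)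
    (hY : Measurable Y) (hind : Indep m₁ (MeasurableSpace.comap Y inferInstance) μ)
    {f : ℝ → ℝ → ENNReal} (hf : Measurable (Function.uncurry f)) :
    ∫⁻ ω, G ω * f (X ω) (Y ω) ∂μ = ∫⁻ ω, G ω * ∫⁻ z, f (X ω) z ∂(μ.map Y) ∂μ := by
  have hGX : Measurable[m₁] (fun ω ↦ (G ω, X ω)) := hG.prodMk hX
  have hGX' : Measurable (fun ω ↦ (G ω, X ω)) := hGX.mono hm le_rfl
  have hI : IndepFun (fun ω ↦ (G ω, X ω)) Y μ := by
    rw [IndepFun_iff_Indep]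
    exact indep_of_indep_of_le_left hind hGX.comap_le
  have hprod := (indepFun_iff_map_prod_eq_prod_map_map hGX'.aemeasurable hY.aemeasurable).1 hI
  have : IsProbabilityMeasure (μ.map Y) := Measure.isProbabilityMeasure_map hY.aemeasurable
  have hg : Measurable (fun p : (ENNReal × ℝ) × ℝ ↦ p.1.1 * f p.1.2 p.2) :=
    (measurable_fst.comp measurable_fst).mul
      (hf.comp ((measurable_snd.comp measurable_fst).prodMk measurable_snd))
  calc ∫⁻ ω, G ω * f (X ω) (Y ω) ∂μ
      = ∫⁻ p, p.1.1 * f p.1.2 p.2 ∂(μ.map (fun ω ↦ ((G ω, X ω), Y ω))) := by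
        rw [lintegral_map hg (hGX'.prodMk hY)]
    _ = ∫⁻ q, ∫⁻ z, q.1 * f q.2 z ∂(μ.map Y) ∂(μ.map (fun ω ↦ (G ω, X ω))) := by
        rw [hprod, lintegral_prod _ hg.aemeasurable]
    _ = ∫⁻ ω, ∫⁻ z, G ω * f (X ω) z ∂(μ.map Y) ∂μ := by
        rw [lintegral_map hg.lintegral_prod_right' hGX']
    _ = _ := by
        refine lintegral_congr fun ω ↦ ?_
        exact lintegral_const_mul _ (hf.comp measurable_prodMk_left)

section Adapted

variable {Ω : Type*} {m : MeasurableSpace Ω} {μ : Measure Ω}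

/-- A stationary Gaussian AR(1) process in causal form: the noise `e` and the process `y` are
adapted to the filtration `F`, the noise at time `t + 1` is independent of `F t`, and the marginal
laws are `N(0, v)` and `N(0, v / (1 - a²))`. -/
structure IsCausalAR1 (y e : ℤ → Ω → ℝ) (F : Filtration ℤ m) (a : ℝ) (v : ℝ≥0)
    (μ : Measure Ω) : Prop where
  measurable_y : ∀ t, Measurable[F t] (y t)
  measurable_e : ∀ t, Measurable[F t] (e t)
  indep : ∀ t, Indep (F t) (MeasurableSpace.comap (e (t + 1)) inferInstance) μ
  map_e : ∀ t, μ.map (e t) = gaussianReal 0 v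
  map_y : ∀ t, μ.map (y t) = gaussianReal 0 (v / (1 - a ^ 2).toNNReal)
  ar : IsAR1 y e a μ

namespace IsCausalAR1

variable {y e : ℤ → Ω → ℝ} {F : Filtration ℤ m} {a : ℝ} {v : ℝ≥0}

/-- The score martingale `∑ e (t + 1) y t` over the times `1 ≤ t ≤ k`. -/
def score (y e : ℤ → Ω → ℝ) (k : ℕ) (ω : Ω) : ℝ :=
  ∑ i ∈ Finset.range k, e (i + 2) ω * y (i + 1) ω

/-- The energy `∑ (y t)²` over the times `1 ≤ t ≤ k`. -/
def energy (y : ℤ → Ω → ℝ) (k : ℕ) (ω : Ω) : ℝ :=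
  ∑ i ∈ Finset.range k, y (i + 1) ω ^ 2

theorem measurable_score (h : IsCausalAR1 y e F a v μ) (k : ℕ) :
    Measurable[F (k + 1)] (score y e k) := by
  refine Finset.measurable_fun_sum _ fun i hi ↦ ?_
  have hi' : i < k := Finset.mem_range.1 hi
  exact ((h.measurable_e _).mono (F.mono (by omega)) le_rfl).mul
    ((h.measurable_y _).mono (F.mono (by omega)) le_rfl)

theorem measurable_energy (h : IsCausalAR1 y e F a v μ) (k : ℕ) :
    Measurable[F k] (energy y k) := by
  refine Finset.measurable_fun_sum _ fun i hi ↦ ?_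
  have hi' : i < k := Finset.mem_range.1 hi
  exact ((h.measurable_y _).mono (F.mono (by omega)) le_rfl).pow_const 2

/-- The exponential martingale of the score has mean one. -/
theorem lintegral_exp_score [IsProbabilityMeasure μ] (h : IsCausalAR1 y e F a v μ) (hv : v ≠ 0)
    (θ : ℝ) (k : ℕ) :
    ∫⁻ ω, ENNReal.ofReal (Real.exp (θ * score y e k ω - θ ^ 2 * v / 2 * energy y k ω)) ∂μ = 1 := by
  induction k with
  | zero => simp [score, energy]
  | succ k ih =>
    have hG : Measurable[F (k + 1)] (fun ω ↦
        ENNReal.ofReal (Real.exp (θ * score y e k ω - θ ^ 2 * v / 2 * energy y k ω))) :=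
      (((h.measurable_score k).const_mul θ).sub
        (((h.measurable_energy k).mono (F.mono (by omega)) le_rfl).const_mul _)).exp.ennreal_ofReal
    have he : Measurable (e ((k : ℤ) + 1 + 1)) := (h.measurable_e _).mono (F.le _) le_rfl
    have key := lintegral_mul_of_indep (F.le _) hG (h.measurable_y (k + 1)) he (h.indep _)
      (f := fun x z ↦ ENNReal.ofReal (Real.exp ((θ * x) * z - (θ * x) ^ 2 * v / 2)))
      (by unfold Function.uncurry; fun_prop)
    simp_rw [h.map_e, lintegral_exp_linear_gaussianReal hv, mul_one] at key
    rw [← ih, ← key]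
    refine lintegral_congr fun ω ↦ ?_
    rw [← ENNReal.ofReal_mul (Real.exp_nonneg _), ← Real.exp_add]
    congr 2
    simp only [score, energy, Finset.sum_range_succ, add_assoc, Int.reduceAdd]
    ring

/-- The Laplace transform of the energy, with a weight `c` on the last square. The noise at the
last time is integrated out, which turns the weight `c` at that time into `s + a² c / (1 + c)` one
step earlier, and costs a factor `(1 + c)^(-1/2)`. The function
`g c = (1 - a² + s) (1 / r + c / (r - a²))`, with `r` the dominant root, satisfies
`(1 + c) g (s + a² c / (1 + c)) = r g c`; it is the eigenfunction of this recursion for `r`. -/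
theorem lintegral_exp_energy_le [IsProbabilityMeasure μ] (h : IsCausalAR1 y e F a v μ) (hv : v ≠ 0)
    (ha : a ^ 2 < 1) {s : ℝ} (hs : 0 < s) (k : ℕ) {c : ℝ} (hc : s ≤ c) :
    ∫⁻ ω, ENNReal.ofReal (Real.exp (-(s * energy y k ω + c * y (k + 1) ω ^ 2) / (2 * v))) ∂μ ≤
      ENNReal.ofReal (√((1 - a ^ 2) / (dominantRoot a s ^ k * ((1 - a ^ 2 + s) *
        (1 / dominantRoot a s + c / (dominantRoot a s - a ^ 2)))))) := by
  have hr1 := one_lt_dominantRoot (a := a) hs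
  have hrs := one_add_le_dominantRoot (a := a) hs
  have hreq := dominantRoot_eq (a := a) hs.le
  set r := dominantRoot a s
  have hr0 : 0 < r := by linarith
  have hra : 0 < r - a ^ 2 := by linarith
  have hb : 0 < 1 - a ^ 2 := by linarith
  have hvp : 0 < (v : ℝ) := by exact_mod_cast pos_iff_ne_zero.mpr hv
  induction k generalizing c with
  | zero =>
    have hc0 : 0 ≤ c := by linarith
    have hw : v / (1 - a ^ 2).toNNReal ≠ 0 := div_ne_zero hv (by simpa using hb)
    have hy : Measurable (y 1) := (h.measurable_y _).mono (F.le _) le_rfl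
    have hlap := lintegral_exp_neg_sq_gaussianReal hw (div_nonneg hc0 hb.le) 0
    rw [← h.map_y 1, lintegral_map (by fun_prop) hy] at hlap
    have hle : (1 - a ^ 2 + s) * (1 / r + c / (r - a ^ 2)) ≤ 1 - a ^ 2 + c := by
      rw [div_add_div _ _ hr0.ne' hra.ne', mul_div_assoc', div_le_iff₀ (by positivity)]
      -- both sides agree at `c = s`, and the slope in `c` is smaller on the left
      have h1 : 0 ≤ (c - s) * (r * (r - 1 - s)) :=
        mul_nonneg (by linarith) (mul_nonneg hr0.le (by linarith))
      have h2 : (1 - a ^ 2 + c) * (r * (r - a ^ 2)) -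
          (1 - a ^ 2 + s) * (1 * (r - a ^ 2) + r * c) = (c - s) * (r * (r - 1 - s)) := by
        linear_combination (-(1 - a ^ 2 + s)) * hreq
      linarith
    calc _ = ∫⁻ ω, ENNReal.ofReal (Real.exp (-(c / (1 - a ^ 2) * (0 + y 1 ω) ^ 2) /
            (2 * (v / (1 - a ^ 2).toNNReal : ℝ≥0)))) ∂μ := by
          refine lintegral_congr fun ω ↦ ?_
          simp only [energy, Finset.range_zero, Finset.sum_empty, Nat.cast_zero, zero_add,
            NNReal.coe_div, Real.coe_toNNReal _ hb.le, mul_zero]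
          congr 2
          field_simp
      _ ≤ _ := by
          rw [hlap]
          refine ENNReal.ofReal_le_ofReal ?_
          simp only [ne_eq, OfNat.ofNat_ne_zero, not_false_eq_true, zero_pow, mul_zero, neg_zero,
            zero_div, Real.exp_zero, mul_one, pow_zero, one_mul]
          rw [← Real.sqrt_inv]
          refine Real.sqrt_le_sqrt ?_
          have : (1 + c / (1 - a ^ 2))⁻¹ = (1 - a ^ 2) / (1 - a ^ 2 + c) := by field_simp
          rw [this]
          exact div_le_div_of_nonneg_left hb.le (by positivity) hle
  | succ k ih =>
    have hc0 : 0 < c := by linarith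
    have hc1 : 0 < 1 + c := by linarith
    have hG : Measurable[F (k + 1)] (fun ω ↦
        ENNReal.ofReal (Real.exp (-(s * energy y (k + 1) ω) / (2 * v)))) :=
      (((h.measurable_energy (k + 1)).const_mul s).neg.div_const _).exp.ennreal_ofReal
    have he : Measurable (e ((k : ℤ) + 1 + 1)) := (h.measurable_e _).mono (F.le _) le_rfl
    have key := lintegral_mul_of_indep (F.le _) hG (h.measurable_y (k + 1)) he (h.indep _)
      (f := fun x z ↦ ENNReal.ofReal (Real.exp (-(c * (a * x + z) ^ 2) / (2 * v))))
      (by unfold Function.uncurry; fun_prop)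
    simp_rw [h.map_e, lintegral_exp_neg_sq_gaussianReal hv hc0.le] at key
    have hc' : s ≤ s + a ^ 2 * c / (1 + c) := by
      have : 0 ≤ a ^ 2 * c / (1 + c) := by positivity
      linarith
    calc _ = ∫⁻ ω, ENNReal.ofReal (Real.exp (-(s * energy y (k + 1) ω) / (2 * v))) *
            ENNReal.ofReal (Real.exp (-(c * (a * y (k + 1) ω + e (k + 1 + 1) ω) ^ 2) /
              (2 * v))) ∂μ := by
          refine lintegral_congr_ae ?_
          filter_upwards [h.ar (k + 1 + 1)] with ω hω
          rw [← ENNReal.ofReal_mul (Real.exp_nonneg _), ← Real.exp_add]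
          push_cast
          rw [hω, add_sub_cancel_right]
          congr 2
          ring
      _ = ENNReal.ofReal (√(1 + c))⁻¹ * ∫⁻ ω, ENNReal.ofReal (Real.exp (-(s * energy y k ω +
            (s + a ^ 2 * c / (1 + c)) * y (k + 1) ω ^ 2) / (2 * v))) ∂μ := by
          rw [key, ← lintegral_const_mul' _ _ ENNReal.ofReal_ne_top]
          refine lintegral_congr fun ω ↦ ?_
          rw [← ENNReal.ofReal_mul (Real.exp_nonneg _), ← ENNReal.ofReal_mul (by positivity),
            mul_left_comm, ← Real.exp_add]
          congr 3
          simp only [energy, Finset.sum_range_succ]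
          ring
      _ ≤ ENNReal.ofReal (√(1 + c))⁻¹ * _ := mul_le_mul_right (ih hc') _
      _ = _ := by
          rw [← ENNReal.ofReal_mul (by positivity), ← Real.sqrt_inv,
            ← Real.sqrt_mul (by positivity), inv_mul_eq_div, div_div]
          congr 3
          have hs' : s = (r - 1) * (r - a ^ 2) / r := by
            field_simp
            linear_combination hreq
          have : (1 + c) * (1 / r + (s + a ^ 2 * c / (1 + c)) / (r - a ^ 2)) =
              r * (1 / r + c / (r - a ^ 2)) := by
            rw [hs']
            field_simp
            ring
          linear_combination (r ^ k * (1 - a ^ 2 + s)) * this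

end IsCausalAR1

end Adapted

/-! ### Deviation and second moment of the least squares estimate -/

theorem sum_Icc_int_eq_sum_range (f : ℤ → ℝ) (b : ℤ) (k : ℕ) :
    ∑ t ∈ Finset.Icc b (b + k), f t = ∑ i ∈ Finset.range (k + 1), f (i + b) := by
  refine Finset.sum_nbij' (fun t ↦ (t - b).toNat) (fun i ↦ i + b) ?_ ?_ ?_ ?_ ?_ <;>
    intro t ht <;> simp at ht ⊢ <;> first | omega | (congr 1; omega)

namespace IsCausalAR1

variable {Ω : Type*} {m : MeasurableSpace Ω} {μ : Measure Ω} {y e : ℤ → Ω → ℝ}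
  {F : Filtration ℤ m} {a : ℝ} {v : ℝ≥0}

theorem score_eq_zero_of_energy_eq_zero {k : ℕ} {ω : Ω} (h : energy y k ω = 0) :
    score y e k ω = 0 := by
  have h0 := (Finset.sum_eq_zero_iff_of_nonneg
    (fun (i : ℕ) (_ : i ∈ Finset.range k) ↦ sq_nonneg (y (i + 1) ω))).1 h
  refine Finset.sum_eq_zero fun i hi ↦ ?_
  rw [pow_eq_zero_iff two_ne_zero |>.1 (h0 i hi), mul_zero]

theorem lsEstimate_ae_eq (h : IsCausalAR1 y e F a v μ) (k : ℕ) :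
    lsEstimate y (k + 2) =ᵐ[μ]
      fun ω ↦ (a * energy y (k + 1) ω + score y e (k + 1) ω) / energy y (k + 1) ω := by
  filter_upwards [ae_all_iff.2 fun t ↦ h.ar t] with ω hω
  have h1 := sum_Icc_int_eq_sum_range (fun t ↦ y t ω * y (t - 1) ω) 2 k
  have h2 := sum_Icc_int_eq_sum_range (fun t ↦ y t ω ^ 2) 1 k
  rw [show (2 : ℤ) + k = ((k + 2 : ℕ) : ℤ) by push_cast; ring] at h1
  rw [show (1 : ℤ) + k = ((k + 2 : ℕ) : ℤ) - 1 by push_cast; ring] at h2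
  simp only [lsEstimate, h1, h2, energy, score]
  congr 1
  rw [Finset.mul_sum, ← Finset.sum_add_distrib]
  refine Finset.sum_congr rfl fun i _ ↦ ?_
  rw [hω (i + 2), show (i : ℤ) + 2 - 1 = i + 1 by ring]
  ring

theorem aemeasurable_lsEstimate (h : IsCausalAR1 y e F a v μ) (k : ℕ) :
    AEMeasurable (lsEstimate y (k + 2)) μ := by
  refine AEMeasurable.congr ?_ (h.lsEstimate_ae_eq k).symm
  have hM : Measurable (score y e (k + 1)) := (h.measurable_score _).mono (F.le _) le_rfl
  have hE : Measurable (energy y (k + 1)) := (h.measurable_energy _).mono (F.le _) le_rfl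
  fun_prop

/-- The Chernoff bound for either tail (`η = 1` or `η = -1`), with exponent `ε / (2 v)`. The
Cauchy-Schwarz inequality separates the score, which contributes an exponential martingale, from
the energy, which contributes the square root of its Laplace transform at `ε² / (2 v)`. -/
theorem measure_energy_le_score_le [IsProbabilityMeasure μ] (h : IsCausalAR1 y e F a v μ)
    (hv : v ≠ 0) (ha : a ^ 2 < 1) {ε η : ℝ} (hε : 0 < ε) (hη : η ^ 2 = 1) (k : ℕ) :
    μ {ω | ε * energy y (k + 1) ω ≤ η * score y e (k + 1) ω} ≤
      ENNReal.ofReal (((1 - a ^ 2) / (1 - a ^ 2 + ε ^ 2)) ^ (1 / 4 : ℝ) *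
        dominantRoot a (ε ^ 2) ^ (-(k : ℝ) / 4)) := by
  have hvp : 0 < (v : ℝ) := by exact_mod_cast pos_iff_ne_zero.mpr hv
  have hs : 0 < ε ^ 2 := by positivity
  have hb : 0 < 1 - a ^ 2 := by linarith
  have hM : Measurable (score y e (k + 1)) := (h.measurable_score _).mono (F.le _) le_rfl
  have hE : Measurable (energy y (k + 1)) := (h.measurable_energy _).mono (F.le _) le_rfl
  set f : Ω → ENNReal := fun ω ↦ ENNReal.ofReal (Real.exp
    (η * ε / (2 * v) * score y e (k + 1) ω - ε ^ 2 / (4 * v) * energy y (k + 1) ω)) with hf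
  set g : Ω → ENNReal := fun ω ↦ ENNReal.ofReal (Real.exp
    (-(ε ^ 2 / (4 * v) * energy y (k + 1) ω))) with hg
  have hfm : Measurable f := by fun_prop
  have hgm : Measurable g := by fun_prop
  have hf2 : ∫⁻ ω, f ω ^ (2 : ℝ) ∂μ = 1 := by
    rw [← h.lintegral_exp_score hv (η * ε / v) (k + 1)]
    refine lintegral_congr fun ω ↦ ?_
    rw [ENNReal.rpow_two, hf, ← ENNReal.ofReal_pow (Real.exp_nonneg _), ← Real.exp_nat_mul]
    congr 2
    rw [div_pow, mul_pow, hη]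
    push_cast
    field_simp
    ring
  have hg2 : ∫⁻ ω, g ω ^ (2 : ℝ) ∂μ ≤ ENNReal.ofReal
      (√((1 - a ^ 2) / (dominantRoot a (ε ^ 2) ^ k * (1 - a ^ 2 + ε ^ 2)))) := by
    have hr1 := one_lt_dominantRoot (a := a) hs
    have hreq := dominantRoot_eq (a := a) hs.le
    have key := h.lintegral_exp_energy_le hv ha hs k le_rfl
    set r := dominantRoot a (ε ^ 2)
    have hr0 : 0 < r := by linarith
    have hra : 0 < r - a ^ 2 := by linarith
    have hone : 1 / r + ε ^ 2 / (r - a ^ 2) = 1 := by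
      field_simp
      linear_combination hreq
    rw [hone, mul_one] at key
    refine le_of_eq_of_le (lintegral_congr fun ω ↦ ?_) key
    rw [ENNReal.rpow_two, hg, ← ENNReal.ofReal_pow (Real.exp_nonneg _), ← Real.exp_nat_mul]
    congr 2
    simp only [energy, Finset.sum_range_succ]
    push_cast
    field_simp
    ring
  calc μ {ω | ε * energy y (k + 1) ω ≤ η * score y e (k + 1) ω}
      ≤ μ {ω | 1 ≤ (f * g) ω} := by
        refine measure_mono fun ω hω ↦ ?_
        have hω' : ε * energy y (k + 1) ω ≤ η * score y e (k + 1) ω := hω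
        change 1 ≤ f ω * g ω
        rw [hf, hg, ← ENNReal.ofReal_mul (Real.exp_nonneg _), ← Real.exp_add, ENNReal.one_le_ofReal,
          Real.one_le_exp_iff]
        have : 0 ≤ ε / (2 * v) * (η * score y e (k + 1) ω - ε * energy y (k + 1) ω) :=
          mul_nonneg (by positivity) (by linarith)
        refine this.trans_eq ?_
        field_simp
        ring
    _ ≤ ∫⁻ ω, (f * g) ω ∂μ := by
        simpa using mul_meas_ge_le_lintegral (μ := μ) (hfm.mul hgm) 1
    _ ≤ (∫⁻ ω, f ω ^ (2 : ℝ) ∂μ) ^ (1 / 2 : ℝ) * (∫⁻ ω, g ω ^ (2 : ℝ) ∂μ) ^ (1 / 2 : ℝ) :=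
        ENNReal.lintegral_mul_le_Lp_mul_Lq μ Real.HolderConjugate.two_two hfm.aemeasurable
          hgm.aemeasurable
    _ ≤ (ENNReal.ofReal (√((1 - a ^ 2) / (dominantRoot a (ε ^ 2) ^ k *
          (1 - a ^ 2 + ε ^ 2))))) ^ (1 / 2 : ℝ) := by
        rw [hf2, ENNReal.one_rpow, one_mul]
        exact ENNReal.rpow_le_rpow hg2 (by norm_num)
    _ = _ := by
        have hr0 : 0 < dominantRoot a (ε ^ 2) := one_pos.trans (one_lt_dominantRoot hs)
        rw [ENNReal.ofReal_rpow_of_nonneg (Real.sqrt_nonneg _) (by norm_num), Real.sqrt_eq_rpow,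
          ← Real.rpow_mul (by positivity)]
        congr 1
        rw [mul_comm (_ ^ k), ← div_div, Real.div_rpow (by positivity) (by positivity),
          ← Real.rpow_natCast _ k, ← Real.rpow_mul hr0.le, div_eq_mul_inv _ (_ ^ (_ : ℝ)),
          ← Real.rpow_neg hr0.le]
        congr 2 <;> ring

theorem measure_lt_lsEstimate_sub_le [IsProbabilityMeasure μ] (h : IsCausalAR1 y e F a v μ)
    (hv : v ≠ 0) (ha : a ^ 2 < 1) {ε η : ℝ} (hε : 0 < ε) (hη : η ^ 2 = 1) (k : ℕ) :
    μ {ω | ε < η * (lsEstimate y (k + 2) ω - a)} ≤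
      ENNReal.ofReal (((1 - a ^ 2) / (1 - a ^ 2 + ε ^ 2)) ^ (1 / 4 : ℝ) *
        dominantRoot a (ε ^ 2) ^ (-(k : ℝ) / 4)) := by
  refine le_trans (measure_mono_ae ?_) (h.measure_energy_le_score_le hv ha hε hη k)
  filter_upwards [h.lsEstimate_ae_eq k] with ω hω hlt
  change ε < η * (lsEstimate y (k + 2) ω - a) at hlt
  change ε * energy y (k + 1) ω ≤ η * score y e (k + 1) ω
  have hE : 0 ≤ energy y (k + 1) ω := Finset.sum_nonneg fun i _ ↦ sq_nonneg _
  rcases hE.eq_or_lt with h0 | hpos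
  · -- the estimate is the junk value `0` here, but the score vanishes as well
    rw [score_eq_zero_of_energy_eq_zero h0.symm, ← h0]
    simp
  · have : η * (lsEstimate y (k + 2) ω - a) =
        η * score y e (k + 1) ω / energy y (k + 1) ω := by
      rw [hω]
      field_simp
      ring
    rw [this, lt_div_iff₀ hpos] at hlt
    exact hlt.le

/-- The second moment is twice the integral over `s = ε²` of the tail bound, where the factor with
exponent `1 / 4` is bounded by one. -/
theorem lintegral_lsEstimate_sub_sq_le [IsProbabilityMeasure μ] (h : IsCausalAR1 y e F a v μ)
    (hv : v ≠ 0) (ha : a ^ 2 < 1) {k : ℕ} (hk : 5 ≤ k) :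
    ∫⁻ ω, ENNReal.ofReal ((lsEstimate y (k + 2) ω - a) ^ 2) ∂μ ≤
      ENNReal.ofReal (8 / ((k : ℝ) - 4) - 8 * a ^ 2 / ((k : ℝ) + 4)) := by
  have hk' : (5 : ℝ) ≤ k := by exact_mod_cast hk
  rw [lintegral_eq_lintegral_meas_lt μ (Filter.Eventually.of_forall fun ω ↦ sq_nonneg _)
    (((h.aemeasurable_lsEstimate k).sub_const a).pow_const 2)]
  have htail : ∀ s ∈ Set.Ioi (0 : ℝ), μ {ω | s < (lsEstimate y (k + 2) ω - a) ^ 2} ≤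
      2 * ENNReal.ofReal (dominantRoot a s ^ (-((k : ℝ) / 4))) := by
    intro s hs
    have hs : 0 < s := hs
    have hone : ∀ η : ℝ, η ^ 2 = 1 → μ {ω | √s < η * (lsEstimate y (k + 2) ω - a)} ≤
        ENNReal.ofReal (dominantRoot a s ^ (-((k : ℝ) / 4))) := by
      intro η hη
      refine (h.measure_lt_lsEstimate_sub_le hv ha (Real.sqrt_pos.2 hs) hη k).trans
        (ENNReal.ofReal_le_ofReal ?_)
      rw [Real.sq_sqrt hs.le, neg_div]
      have hr0 : 0 < dominantRoot a s := one_pos.trans (one_lt_dominantRoot hs)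
      have hb : 0 < 1 - a ^ 2 := by linarith
      refine mul_le_of_le_one_left (by positivity) (Real.rpow_le_one (by positivity) ?_
        (by norm_num))
      rw [div_le_one (by positivity)]
      linarith
    calc μ {ω | s < (lsEstimate y (k + 2) ω - a) ^ 2}
        ≤ μ ({ω | √s < 1 * (lsEstimate y (k + 2) ω - a)} ∪
            {ω | √s < -1 * (lsEstimate y (k + 2) ω - a)}) := by
          refine measure_mono fun ω hω ↦ ?_
          have : √s < |lsEstimate y (k + 2) ω - a| := by
            rw [← Real.sqrt_sq_eq_abs]
            exact Real.sqrt_lt_sqrt hs.le hω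
          simpa [lt_abs] using this
      _ ≤ _ := (measure_union_le _ _).trans
          ((add_le_add (hone 1 (by norm_num)) (hone (-1) (by norm_num))).trans_eq
            (two_mul _).symm)
  refine (setLIntegral_mono' measurableSet_Ioi htail).trans_eq ?_
  rw [lintegral_const_mul' _ _ (by norm_num), lintegral_dominantRoot_rpow ha (by linarith),
    ← ENNReal.ofReal_ofNat 2, ← ENNReal.ofReal_mul (by norm_num)]
  congr 1
  have h1 : (k : ℝ) - 4 ≠ 0 := by linarith
  have h2 : (k : ℝ) + 4 ≠ 0 := by linarith
  have h3 : (k : ℝ) / 4 - 1 ≠ 0 := by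
    intro h0
    apply h1
    linarith
  field_simp
  ring

end IsCausalAR1

/-! ### Causality of the stationary solution -/

section Causality

open Filter Topology

variable {Ω : Type*} {m : MeasurableSpace Ω} {μ : Measure Ω} {y e : ℤ → Ω → ℝ} {a : ℝ}

theorem IsStationaryProcess.identDistrib (h : IsStationaryProcess y μ) (s t : ℤ) :
    IdentDistrib (y s) (y t) μ μ := by
  have := (h {s} (t - s)).comp
    (measurable_pi_apply (⟨s, Finset.mem_singleton_self s⟩ : ({s} : Finset ℤ)))
  simpa [Function.comp_def] using this

theorem IsAR1.ae_eq_sum_add (h : IsAR1 y e a μ) (t : ℤ) (n : ℕ) :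
    ∀ᵐ ω ∂μ, y t ω = ∑ k ∈ Finset.range n, a ^ k * e (t - k) ω + a ^ n * y (t - n) ω := by
  induction n with
  | zero => simp
  | succ n ih =>
    filter_upwards [ih, h (t - n)] with ω h1 h2
    rw [h1, h2, Finset.sum_range_succ, show t - (n : ℤ) - 1 = t - ((n + 1 : ℕ) : ℤ) by
      push_cast; ring]
    ring

/-- The partial sums of the moving average representation converge in probability to the stationary
solution, since by stationarity the remainder `a ^ n * y (t - n)` has the law of `a ^ n * y t`. -/
theorem IsAR1.tendstoInMeasure [IsProbabilityMeasure μ] (h : IsAR1 y e a μ) (ha : |a| < 1)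
    (hs : IsStationaryProcess y μ) (t : ℤ) :
    TendstoInMeasure μ (fun n ω ↦ ∑ k ∈ Finset.range n, a ^ k * e (t - k) ω) atTop (y t) := by
  have hy : AEMeasurable (y t) μ := (hs.identDistrib t t).aemeasurable_fst
  have h0 : TendstoInMeasure μ (fun (n : ℕ) ω ↦ a ^ n * y t ω) atTop (fun _ ↦ (0 : ℝ)) := by
    refine tendstoInMeasure_of_tendsto_ae (fun n ↦ (hy.const_mul _).aestronglyMeasurable)
      (Eventually.of_forall fun ω ↦ ?_)
    simpa using (tendsto_pow_atTop_nhds_zero_of_abs_lt_one ha).mul_const (y t ω)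
  intro δ hδ
  refine (h0 δ hδ).congr fun n ↦ ?_
  have hS : MeasurableSet {x : ℝ | δ ≤ edist (a ^ n * x) 0} :=
    measurableSet_le measurable_const (by fun_prop)
  have h1 := (hs.identDistrib t (t - n)).measure_mem_eq hS
  refine h1.trans (measure_congr ?_)
  filter_upwards [h.ae_eq_sum_add t n] with ω hω
  refine propext ?_
  change δ ≤ edist (a ^ n * y (t - n) ω) 0 ↔ δ ≤ edist _ (y t ω)
  rw [hω, edist_comm _ (_ + _), edist_dist, edist_dist, Real.dist_eq, Real.dist_eq]
  simp

/-- The stationary law of the AR(1) equation with Gaussian noise: the characteristic function `φ`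
satisfies `φ u = φ (a u) exp (-v u² / 2)`, and iterating this determines it, by continuity
at `0`. -/
theorem IsStationaryProcess.map_eq_gaussianReal [IsProbabilityMeasure μ]
    (hs : IsStationaryProcess y μ) (h : IsAR1 y e a μ) (ha : |a| < 1) {v : ℝ≥0}
    (he : ∀ t, HasLaw (e t) (gaussianReal 0 v) μ) (t : ℤ) (hind : IndepFun (y (t - 1)) (e t) μ) :
    μ.map (y t) = gaussianReal 0 (v / (1 - a ^ 2).toNNReal) := by
  have hy : ∀ t, AEMeasurable (y t) μ := fun t ↦ (hs.identDistrib t t).aemeasurable_fst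
  have : IsProbabilityMeasure (μ.map (y t)) := Measure.isProbabilityMeasure_map (hy t)
  have ha2 : a ^ 2 < 1 := by rw [← sq_abs]; exact pow_lt_one₀ (abs_nonneg a) ha two_ne_zero
  have hb : 0 < 1 - a ^ 2 := by linarith
  have hrec : ∀ u, charFun (μ.map (y t)) u =
      charFun (μ.map (y t)) (a * u) * Complex.exp (-(v * u ^ 2 / 2 : ℝ)) := by
    intro u
    have h1 : μ.map (y t) = μ.map (fun ω ↦ a * y (t - 1) ω + e t ω) := Measure.map_congr (h t)
    have h2 : IndepFun (fun ω ↦ a * y (t - 1) ω) (e t) μ :=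
      hind.comp (φ := fun x ↦ a * x) (ψ := id) (by fun_prop) measurable_id
    conv_lhs => rw [h1]
    rw [h2.charFun_map_fun_add_eq_mul ((hy _).const_mul a) (he t).aemeasurable, Pi.mul_apply,
      charFun_map_mul_comp (hy _), (hs.identDistrib (t - 1) t).map_eq, (he t).map_eq,
      charFun_gaussianReal]
    congr 2
    push_cast
    ring
  have hiter : ∀ (n : ℕ) u, charFun (μ.map (y t)) u = charFun (μ.map (y t)) (a ^ n * u) *
      Complex.exp (-(v * u ^ 2 / 2 * ((1 - (a ^ 2) ^ n) / (1 - a ^ 2)) : ℝ)) := by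
    intro n u
    induction n with
    | zero => simp
    | succ n ih =>
      rw [ih, hrec (a ^ n * u), mul_assoc, ← Complex.exp_add, ← mul_assoc, ← pow_succ']
      congr 2
      rw [← Complex.ofReal_neg, ← Complex.ofReal_neg, ← Complex.ofReal_neg, ← Complex.ofReal_add]
      congr 1
      field_simp
      ring
  refine Measure.ext_of_charFun (funext fun u ↦ ?_)
  have hpow : Tendsto (fun n : ℕ ↦ a ^ n * u) atTop (𝓝 0) := by
    simpa using (tendsto_pow_atTop_nhds_zero_of_abs_lt_one ha).mul_const u
  have hpow2 : Tendsto (fun n : ℕ ↦ (a ^ 2) ^ n) atTop (𝓝 0) :=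
    tendsto_pow_atTop_nhds_zero_of_lt_one (sq_nonneg a) ha2
  have hcont : Continuous (charFun (μ.map (y t))) := by fun_prop
  have hlim1 := (hcont.tendsto 0).comp hpow
  have hlim2 : Tendsto (fun n : ℕ ↦
      Complex.exp (-(v * u ^ 2 / 2 * ((1 - (a ^ 2) ^ n) / (1 - a ^ 2)) : ℝ))) atTop
      (𝓝 (Complex.exp (-(v * u ^ 2 / 2 * ((1 - 0) / (1 - a ^ 2)) : ℝ)))) := by
    have hc : Continuous fun x : ℝ ↦
        Complex.exp (-(v * u ^ 2 / 2 * ((1 - x) / (1 - a ^ 2)) : ℝ)) := by fun_prop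
    exact (hc.tendsto 0).comp hpow2
  have hlim := (hlim1.mul hlim2).congr fun n ↦ (hiter n u).symm
  rw [tendsto_nhds_unique tendsto_const_nhds hlim, charFun_zero, charFun_gaussianReal]
  simp only [probReal_univ, Complex.ofReal_one, one_mul]
  congr 1
  rw [NNReal.coe_div, Real.coe_toNNReal _ hb.le]
  push_cast
  ring

/-- A stationary solution of the AR(1) equation driven by a Gaussian white noise is a modification
of a causal one. The filtration is the natural filtration of (a measurable modification of) the
noise; the process is adapted to it as the almost sure limit of a subsequence of the partial sums
of its moving average representation. -/
theorem exists_isCausalAR1 [IsProbabilityMeasure μ] (ha : |a| < 1) {v : ℝ≥0}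
    (he : IsGaussianWhiteNoise e v μ) (h : IsAR1 y e a μ) (hs : IsStationaryProcess y μ) :
    ∃ (y' e' : ℤ → Ω → ℝ) (F : Filtration ℤ m), IsCausalAR1 y' e' F a v μ ∧
      ∀ t, y t =ᵐ[μ] y' t := by
  set e' : ℤ → Ω → ℝ := fun t ↦ (he.hasLaw t).aemeasurable.mk (e t) with he'
  have hee' : ∀ t, e t =ᵐ[μ] e' t := fun t ↦ (he.hasLaw t).aemeasurable.ae_eq_mk
  have hme' : ∀ t, Measurable (e' t) := fun t ↦ (he.hasLaw t).aemeasurable.measurable_mk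
  have hind : iIndep (fun t ↦ MeasurableSpace.comap (e' t) inferInstance) μ :=
    (iIndepFun_iff_iIndep _ _ _).1 (he.indep.congr hee')
  have h' : IsAR1 y e' a μ := fun t ↦ by
    filter_upwards [h t, hee' t] with ω h1 h2
    rw [h1, h2]
  have hlaw : ∀ t, HasLaw (e' t) (gaussianReal 0 v) μ := fun t ↦
    ⟨(hme' t).aemeasurable, by rw [← (he.hasLaw t).map_eq, Measure.map_congr (hee' t)]⟩
  let F : Filtration ℤ m :=
    { seq := fun t ↦ ⨆ s ∈ Set.Iic t, MeasurableSpace.comap (e' s) inferInstance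
      mono' := fun s t hst ↦ biSup_mono fun i hi ↦ le_trans hi hst
      le' := fun t ↦ iSup₂_le fun s _ ↦ (hme' s).comap_le }
  have hadapt : ∀ s t, s ≤ t → Measurable[F t] (e' s) := fun s t hst ↦
    measurable_iff_comap_le.2
      (le_biSup (fun s ↦ MeasurableSpace.comap (e' s) inferInstance) (Set.mem_Iic.2 hst))
  have hFind : ∀ t, Indep (F t) (MeasurableSpace.comap (e' (t + 1)) inferInstance) μ := by
    intro t
    have := indep_iSup_of_disjoint (fun s ↦ (hme' s).comap_le) hind
      (S := Set.Iic t) (T := {t + 1}) (by simp)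
    rwa [iSup_singleton] at this
  choose ns hns hlim using fun t ↦ (h'.tendstoInMeasure ha hs t).exists_seq_tendsto_ae
  set y' : ℤ → Ω → ℝ := fun t ω ↦
    limsup (fun i ↦ ∑ k ∈ Finset.range (ns t i), a ^ k * e' (t - k) ω) atTop with hy'
  have hyy' : ∀ t, y t =ᵐ[μ] y' t := fun t ↦ by
    filter_upwards [hlim t] with ω hω
    exact hω.limsup_eq.symm
  have hmy' : ∀ t, Measurable[F t] (y' t) := fun t ↦ by
    refine Measurable.limsup fun i ↦ Finset.measurable_fun_sum _ fun k _ ↦ ?_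
    exact (hadapt _ _ (by omega)).const_mul _
  refine ⟨y', e', F, ⟨hmy', fun t ↦ hadapt t t le_rfl, hFind, fun t ↦ (hlaw t).map_eq,
    fun t ↦ ?_, fun t ↦ ?_⟩, hyy'⟩
  · rw [← Measure.map_congr (hyy' t)]
    refine hs.map_eq_gaussianReal h' ha hlaw t ?_
    have h1 : IndepFun (y' (t - 1)) (e' t) μ := by
      rw [IndepFun_iff_Indep]
      have := hFind (t - 1)
      rw [sub_add_cancel] at this
      exact indep_of_indep_of_le_left this (hmy' (t - 1)).comap_le
    exact h1.congr (hyy' (t - 1)).symm EventuallyEq.rfl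
  · filter_upwards [h' t, hyy' t, hyy' (t - 1)] with ω h1 h2 h3
    rw [← h2, ← h3, h1]

end Causality

theorem theorem1 {Ω : Type*} [MeasurableSpace Ω] (μ : Measure Ω) [IsProbabilityMeasure μ]
    (a₀ : ℝ) (ha₀ : |a₀| < 1) (v : ℝ≥0) (hv : 0 < v) (y e : ℤ → Ω → ℝ)
    (he : IsGaussianWhiteNoise e v μ) (hy : IsAR1 y e a₀ μ) (hstat : IsStationaryProcess y μ) :
    (∀ ε : ℝ, 0 < ε → ∀ N : ℕ, 2 ≤ N →
      μ.real {ω | lsEstimate y N ω - a₀ > ε} ≤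
        ((1 - a₀ ^ 2) / (1 - a₀ ^ 2 + ε ^ 2)) ^ (1 / 4 : ℝ) *
          ((1 + a₀ ^ 2 + ε ^ 2) / 2 +
            Real.sqrt (((1 + a₀ ^ 2 + ε ^ 2) / 2) ^ 2 - a₀ ^ 2)) ^ (-((N : ℝ) - 2) / 4)) ∧
    (∀ N : ℕ, 7 ≤ N →
      Integrable (fun ω ↦ (lsEstimate y N ω - a₀) ^ 2) μ ∧
      ∫ ω, (lsEstimate y N ω - a₀) ^ 2 ∂μ ≤ 8 / ((N : ℝ) - 6) - 8 * a₀ ^ 2 / ((N : ℝ) + 2)) := by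
  obtain ⟨y', e', F, hc, hyy'⟩ := exists_isCausalAR1 ha₀ he hy hstat
  have ha2 : a₀ ^ 2 < 1 := by rw [← sq_abs]; exact pow_lt_one₀ (abs_nonneg _) ha₀ two_ne_zero
  have hls : ∀ N, lsEstimate y N =ᵐ[μ] lsEstimate y' N := fun N ↦ by
    filter_upwards [ae_all_iff.2 hyy'] with ω hω
    simp only [lsEstimate, hω]
  refine ⟨fun ε hε N hN ↦ ?_, fun N hN ↦ ?_⟩
  · obtain ⟨k, rfl⟩ : ∃ k, N = k + 2 := ⟨N - 2, by omega⟩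
    have hb : 0 < 1 - a₀ ^ 2 := by linarith
    have hr : 0 < dominantRoot a₀ (ε ^ 2) := one_pos.trans (one_lt_dominantRoot (by positivity))
    have key := hc.measure_lt_lsEstimate_sub_le hv.ne' ha2 hε (one_pow 2) k
    have hset : {ω | lsEstimate y (k + 2) ω - a₀ > ε} =ᵐ[μ]
        {ω | ε < 1 * (lsEstimate y' (k + 2) ω - a₀)} := by
      filter_upwards [hls (k + 2)] with ω hω
      refine propext ?_
      change lsEstimate y (k + 2) ω - a₀ > ε ↔ ε < 1 * (lsEstimate y' (k + 2) ω - a₀)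
      rw [hω, one_mul]
    rw [measureReal_congr hset]
    refine (ENNReal.toReal_le_of_le_ofReal (by positivity) key).trans_eq ?_
    rw [show -(((k + 2 : ℕ) : ℝ) - 2) / 4 = -(k : ℝ) / 4 by push_cast; ring, dominantRoot]
  · obtain ⟨k, rfl⟩ : ∃ k, N = k + 2 := ⟨N - 2, by omega⟩
    have hk : 5 ≤ k := by omega
    have hk' : (5 : ℝ) ≤ k := by exact_mod_cast hk
    have key := hc.lintegral_lsEstimate_sub_sq_le hv.ne' ha2 hk
    have hcongr : (fun ω ↦ (lsEstimate y (k + 2) ω - a₀) ^ 2) =ᵐ[μ]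
        fun ω ↦ (lsEstimate y' (k + 2) ω - a₀) ^ 2 := by
      filter_upwards [hls (k + 2)] with ω hω
      rw [hω]
    have hmeas := ((hc.aemeasurable_lsEstimate k).sub_const a₀).pow_const 2
    have hnn : 0 ≤ᵐ[μ] fun ω ↦ (lsEstimate y' (k + 2) ω - a₀) ^ 2 :=
      Filter.Eventually.of_forall fun ω ↦ sq_nonneg _
    refine ⟨Integrable.congr ⟨hmeas.aestronglyMeasurable, ?_⟩ hcongr.symm, ?_⟩
    · rw [hasFiniteIntegral_iff_ofReal hnn]
      exact key.trans_lt ENNReal.ofReal_lt_top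
    · rw [integral_congr_ae hcongr,
        integral_eq_lintegral_of_nonneg_ae hnn hmeas.aestronglyMeasurable]
      rw [show ((k + 2 : ℕ) : ℝ) - 6 = k - 4 by push_cast; ring,
        show ((k + 2 : ℕ) : ℝ) + 2 = k + 4 by push_cast; ring]
      refine ENNReal.toReal_le_of_le_ofReal ?_ key
      have : 8 * a₀ ^ 2 / ((k : ℝ) + 4) ≤ 8 / ((k : ℝ) - 4) :=
        div_le_div₀ (by norm_num) (by linarith) (by linarith) (by linarith)
      linarith
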